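/- **Theorem 6.9 (faces of the pinwheel tiling).** The pinwheel substitution inflates a right triangle with legs $1$ and $2$ by the factor $\sqrt5$ and dissects the result into five right triangles with legs $1$ and $2$ as follows: if the inflated triangle has its right angle at $R$, short leg $RS$ and long leg $RL$, let $D=S+\tfrac15(L-S)$, $E=S+\tfrac35(L-S)$, let $M$ be the midpoint of $RL$ and $N$ the midpoint of $RD$; the five tiles are the triangles $DSR$, $NRM$, $NDM$, $EMD$, $EML$. The patch obtained from one triangle by $n$ substitutions is called a supertile of level $n$. A pinwheel tiling is a tiling of the plane by such triangles, each finite patch of which is congruent to a part of a supertile. A proper face colouring gives different colours to any two distinct tiles that share a nondegenerate segment of their boundaries. The minimum number of colours needed for a proper face colouring of any pinwheel tiling is exactly $3$. -/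

import Mathlib

namespace Pinwheel

/-- A triangle in the Euclidean plane `ℂ` with labelled vertices: `R` is the vertex at the right
angle, `S` the other end of the short leg, `L` the other end of the long leg. (All triangles used
below are similar to the one with legs `1` and `2`, where the labels are determined by the
shape.) -/
@[ext]
structure Triangle where
  R : ℂ
  S : ℂ
  L : ℂ

namespace Triangle

/-- The closed triangular region. -/
def carrier (t : Triangle) : Set ℂ := convexHull ℝ {t.R, t.S, t.L}

/-- The image under a map of the plane, taken on vertices. -/
def map (f : ℂ → ℂ) (t : Triangle) : Triangle := ⟨f t.R, f t.S, f t.L⟩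

/-- The point of the hypotenuse at one fifth of the way from `S` to `L`
(the foot of the altitude from `R`). -/
noncomputable def ptD (t : Triangle) : ℂ := AffineMap.lineMap t.S t.L (1 / 5 : ℝ)

/-- The point of the hypotenuse at three fifths of the way from `S` to `L`. -/
noncomputable def ptE (t : Triangle) : ℂ := AffineMap.lineMap t.S t.L (3 / 5 : ℝ)

/-- The midpoint of the long leg. -/
noncomputable def ptM (t : Triangle) : ℂ := midpoint ℝ t.R t.L

/-- The midpoint of the altitude from `R`. -/
noncomputable def ptN (t : Triangle) : ℂ := midpoint ℝ t.R t.ptD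

/-- The pinwheel dissection of a triangle into five triangles, smaller by the factor `√5`. -/
noncomputable def dissect (t : Triangle) : Set Triangle :=
  {⟨t.ptD, t.S, t.R⟩, ⟨t.ptN, t.R, t.ptM⟩, ⟨t.ptN, t.ptD, t.ptM⟩,
    ⟨t.ptE, t.ptM, t.ptD⟩, ⟨t.ptE, t.ptM, t.L⟩}

/-- The pinwheel substitution: inflate a tile by `√5` and dissect it. -/
noncomputable def substitute (t : Triangle) : Set Triangle :=
  (t.map fun z => Real.sqrt 5 • z).dissect

end Triangle

/-- The prototile, a right triangle with legs `1` and `2`. -/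
def prototile : Triangle := ⟨0, 1, 2 * Complex.I⟩

/-- The supertile of level `n`: the patch obtained from the prototile by `n` substitutions. -/
noncomputable def supertile : ℕ → Set Triangle
  | 0 => {prototile}
  | n + 1 => ⋃ t ∈ supertile n, t.substitute

/-- A pinwheel tiling: a set of tiles that cover the plane without overlaps, such that each finite
patch is congruent to a part of a supertile. -/
structure IsPinwheelTiling (T : Set Triangle) : Prop where
  covers : ⋃ t ∈ T, t.carrier = Set.univ
  nonoverlapping : ∀ s ∈ T, ∀ t ∈ T, s ≠ t → Disjoint (interior s.carrier) (interior t.carrier)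
  legal : ∀ P : Set Triangle, P ⊆ T → P.Finite →
    ∃ (n : ℕ) (f : ℂ ≃ᵢ ℂ), P ⊆ Triangle.map f '' supertile n

/-- The adjacency graph of the faces: two distinct tiles are adjacent if they share
a nondegenerate segment (not merely a vertex). -/
def faceGraph (T : Set Triangle) : SimpleGraph T where
  Adj s t := s ≠ t ∧ ∃ x y : ℂ, x ≠ y ∧ segment ℝ x y ⊆ s.1.carrier ∩ t.1.carrier
  symm := ⟨fun _ _ h => ⟨h.1.symm, by simpa only [Set.inter_comm] using h.2⟩⟩
  loopless := ⟨fun _ h => h.1 rfl⟩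

end Pinwheel

namespace Pinwheel

/-- Ten times the barycentric coordinates of the vertices of the five parts of a dissected triangle,
with respect to the vertices of that triangle. -/
def childMatrix : Fin 5 → Matrix (Fin 3) (Fin 3) ℤ := ![
  !![0, 8, 2; 0, 10, 0; 10, 0, 0],
  !![5, 4, 1; 10, 0, 0; 5, 0, 5],
  !![5, 4, 1; 0, 8, 2; 5, 0, 5],
  !![0, 4, 6; 5, 0, 5; 0, 8, 2],
  !![0, 4, 6; 5, 0, 5; 0, 0, 10]]

/-- Ten times the barycentric coordinates of the vertices of a tile with respect to a neighbouring
tile, for the eleven ways in which two tiles of a supertile can be neighbours; the last matrix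
describes the tile itself. -/
def positionMatrix : Fin 12 → Matrix (Fin 3) (Fin 3) ℤ := ![
  !![5, 0, 5; 0, 0, 10; 25, -20, 5],
  !![5, 0, 5; 10, 0, 0; 25, -20, 5],
  !![20, -10, 0; 25, -10, -5; 0, 10, 0],
  !![10, 0, 0; 20, -10, 0; 0, 0, 10],
  !![0, 10, 0; 5, 10, -5; 20, -10, 0],
  !![-10, 10, 10; 0, 0, 10; 0, 10, 0],
  !![10, 0, 0; 0, 10, 0; 20, 0, -10],
  !![-10, 16, 4; 0, 10, 0; 0, 0, 10],
  !![5, 0, 5; 15, -10, 5; 15, 0, -5],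
  !![5, 0, 5; 15, -10, 5; -5, 0, 15],
  !![15, 0, -5; 25, -10, -5; 5, 0, 5],
  !![10, 0, 0; 0, 10, 0; 0, 0, 10]]

/-- The transition function of the automaton that labels the tiles of a supertile. -/
def nextLabel : Fin 6 → Fin 5 → Fin 6 := ![
  ![0, 1, 2, 0, 4], ![1, 4, 0, 2, 5], ![5, 3, 4, 1, 2],
  ![4, 5, 1, 4, 3], ![3, 2, 5, 3, 0], ![2, 0, 3, 5, 1]]

/-- The colour of a tile with a given label. -/
def labelColor : Fin 6 → Fin 3 := ![0, 1, 2, 1, 2, 0]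

/-- The labels that can occur on a tile in a given position relative to a tile with a given
label. -/
def neighborLabels : Fin 12 → Fin 6 → List (Fin 6) := ![
  ![[1], [4], [0], [2], [5], [3]],
  ![[2], [0], [3], [5], [1], [4]],
  ![[2], [0], [3], [5], [1], [4]],
  ![[3, 4], [2, 5], [1, 5], [0, 4], [0, 3], [1, 2]],
  ![[1], [4], [0], [2], [5], [3]],
  ![[2], [4], [0], [5], [1], [3]],
  ![[3, 4], [2, 5], [1, 5], [0, 4], [0, 3], [1, 2]],
  ![[3, 4], [2, 5], [1, 5], [0, 4], [0, 3], [1, 2]],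
  ![[1], [0], [3], [2], [5], [4]],
  ![[2], [4], [0], [5], [1], [3]],
  ![[2], [4], [0], [5], [1], [3]],
  ![[0], [1], [2], [3], [4], [5]]]

/-- Linear forms in barycentric coordinates whose kernels separate those parts of two neighbouring
triangles that are not neighbours. -/
def separatingForms : List (Fin 3 → ℤ) :=
  [![0, 1, 0], ![0, 0, 1], ![1, 0, 0], ![4, 1, -4], ![-1, -1, 1], ![1, 2, -1], ![0, -1, 4],
    ![-1, 0, 1], ![1, 1, 0], ![0, -3, 2], ![3, 3, -2]]

open Matrix in
/-- The form `h` separates the triangles with barycentric coordinates `A` and `B`, and vanishes at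
at most one vertex of one of them. -/
def Separates (A B : Matrix (Fin 3) (Fin 3) ℤ) (h : Fin 3 → ℤ) : Prop :=
  (∀ r, 0 ≤ (A *ᵥ h) r) ∧ (∀ r, (B *ᵥ h) r ≤ 0) ∧
    ((∃ r₀, ∀ r, r ≠ r₀ → (A *ᵥ h) r ≠ 0) ∨ ∃ r₀, ∀ r, r ≠ r₀ → (B *ᵥ h) r ≠ 0)

instance (A B : Matrix (Fin 3) (Fin 3) ℤ) (h : Fin 3 → ℤ) : Decidable (Separates A B h) := by
  unfold Separates; infer_instance

theorem childMatrix_mul_positionMatrix (m : Fin 12) (i j : Fin 5) :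
    (∃ m', childMatrix j * positionMatrix m = positionMatrix m' * childMatrix i ∧
      (m' = 11 → m = 11 ∧ i = j) ∧ ∀ a, ∀ b ∈ neighborLabels m a,
        nextLabel b j ∈ neighborLabels m' (nextLabel a i)) ∨
    ∃ h ∈ separatingForms, Separates (childMatrix i) (childMatrix j * positionMatrix m) h := by
  revert m i j
  decide +kernel

theorem sum_childMatrix (i : Fin 5) (r : Fin 3) : ∑ k, childMatrix i r k = 10 := by
  revert i r; decide

theorem sum_childMatrix_mul_positionMatrix (m : Fin 12) (j : Fin 5) (r : Fin 3) :
    ∑ k, (childMatrix j * positionMatrix m) r k = 100 := by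
  revert m j r; decide +kernel

theorem labelColor_ne_of_mem_neighborLabels {m : Fin 12} (hm : m ≠ 11) {a b : Fin 6}
    (h : b ∈ neighborLabels m a) : labelColor a ≠ labelColor b := by
  revert m a b; decide +kernel

/-- Every proper position is on the other side of one of the edges. -/
theorem exists_positionMatrix_nonpos {m : Fin 12} (hm : m ≠ 11) :
    ∃ k, ∀ r, positionMatrix m r k ≤ 0 := by
  revert m; decide +kernel

namespace Triangle

/-- The vertices of a triangle, in the order `R`, `S`, `L`. -/
def vertex (t : Triangle) : Fin 3 → ℂ := ![t.R, t.S, t.L]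

theorem vertex_map (f : ℂ → ℂ) (t : Triangle) (r : Fin 3) :
    (t.map f).vertex r = f (t.vertex r) := by
  fin_cases r <;> rfl

theorem carrier_eq_convexHull_range (t : Triangle) :
    t.carrier = convexHull ℝ (Set.range t.vertex) := by
  rw [carrier, vertex, Matrix.range_cons, Matrix.range_cons, Matrix.range_cons,
    Matrix.range_empty, Set.union_empty]
  rfl

theorem mem_carrier_iff {t : Triangle} {x : ℂ} :
    x ∈ t.carrier ↔ ∃ a : Fin 3 → ℝ, (∀ r, 0 ≤ a r) ∧ ∑ r, a r = 1 ∧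
      ∑ r, a r • t.vertex r = x := by
  have h : Set.range t.vertex =
      Fintype.linearCombination ℝ t.vertex '' Set.range fun i j : Fin 3 => if i = j then (1 : ℝ) else 0 := by
    rw [← Set.range_comp]
    congr 1
    ext i
    simp [Fintype.linearCombination_apply]
  rw [carrier_eq_convexHull_range, h, ← LinearMap.image_convexHull,
    convexHull_basis_eq_stdSimplex]
  simp [stdSimplex, Fintype.linearCombination_apply, and_assoc]

theorem convex_carrier (t : Triangle) : Convex ℝ t.carrier := convex_convexHull ℝ _

theorem vertex_mem_carrier (t : Triangle) (r : Fin 3) : t.vertex r ∈ t.carrier := by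
  rw [carrier_eq_convexHull_range]
  exact subset_convexHull ℝ _ ⟨r, rfl⟩

theorem R_mem_carrier (t : Triangle) : t.R ∈ t.carrier := t.vertex_mem_carrier 0

theorem S_mem_carrier (t : Triangle) : t.S ∈ t.carrier := t.vertex_mem_carrier 1

theorem L_mem_carrier (t : Triangle) : t.L ∈ t.carrier := t.vertex_mem_carrier 2

theorem carrier_map (f : ℂ →ᵃ[ℝ] ℂ) (t : Triangle) : (t.map f).carrier = f '' t.carrier := by
  rw [carrier_eq_convexHull_range, carrier_eq_convexHull_range, AffineMap.image_convexHull,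
    ← Set.range_comp]
  congr 2
  exact funext (vertex_map f t)

theorem carrier_ne_univ (t : Triangle) : t.carrier ≠ Set.univ := by
  have h : IsCompact t.carrier := (Set.toFinite {t.R, t.S, t.L}).isCompact_convexHull ℝ
  exact h.ne_univ

/-- The barycentre of a triangle. -/
noncomputable def center (t : Triangle) : ℂ := Finset.univ.centroid ℝ t.vertex

theorem center_eq (t : Triangle) : t.center = ∑ r, (1 / 3 : ℝ) • t.vertex r := by
  rw [center, Finset.centroid_def, Finset.affineCombination_eq_linear_combination _ _ _
    (Finset.sum_centroidWeights_eq_one_of_nonempty ℝ _ Finset.univ_nonempty)]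
  simp [Finset.centroidWeights]

theorem center_map (f : ℂ →ᵃ[ℝ] ℂ) (t : Triangle) : (t.map f).center = f t.center := by
  rw [center, center, Finset.centroid_def, Finset.centroid_def, Finset.map_affineCombination _ _ _
    (Finset.sum_centroidWeights_eq_one_of_nonempty ℝ _ Finset.univ_nonempty)]
  rw [show (t.map f).vertex = f ∘ t.vertex from funext (vertex_map f t)]

/-- A triangle is nondegenerate if its vertices are not collinear. -/
def Nondegenerate (t : Triangle) : Prop := AffineIndependent ℝ t.vertex

theorem Nondegenerate.center_mem_interior {t : Triangle} (ht : t.Nondegenerate) :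
    t.center ∈ interior t.carrier := by
  have hspan : affineSpan ℝ (Set.range t.vertex) = ⊤ :=
    (AffineIndependent.affineSpan_eq_top_iff_card_eq_finrank_add_one ht).2 (by simp)
  rw [carrier_eq_convexHull_range]
  exact AffineBasis.centroid_mem_interior_convexHull ⟨t.vertex, ht, hspan⟩

/-- If the barycentre of `s` lies in `t`, then `s` and `t` share more than one point. -/
theorem Nondegenerate.not_inter_subset_singleton {s t : Triangle} (hs : s.Nondegenerate)
    (ht : t.Nondegenerate) (h : s.center ∈ t.carrier) (v : ℂ) :
    ¬s.carrier ∩ t.carrier ⊆ {v} := by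
  intro hv
  obtain ⟨r, hr⟩ : ∃ r, t.vertex r ≠ s.center := by
    by_contra! H
    exact absurd (ht.injective ((H 0).trans (H 1).symm)) (by decide)
  have hc : Filter.Tendsto (fun ε : ℝ => AffineMap.lineMap s.center (t.vertex r) ε)
      (nhdsWithin 0 (Set.Ioi 0)) (nhds s.center) := by
    have : Continuous fun ε : ℝ => (AffineMap.lineMap s.center (t.vertex r) ε : ℂ) :=
      AffineMap.lineMap_continuous
    simpa using (this.tendsto 0).mono_left nhdsWithin_le_nhds
  have h1 := hc.eventually (mem_interior_iff_mem_nhds.1 hs.center_mem_interior)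
  have h2 : ∀ᶠ ε : ℝ in nhdsWithin 0 (Set.Ioi 0), ε ∈ Set.Ioo (0 : ℝ) 1 :=
    Ioo_mem_nhdsGT one_pos
  obtain ⟨ε, hε, hε0, hε1⟩ := (h1.and h2).exists
  have h3 : AffineMap.lineMap s.center (t.vertex r) ε ∈ t.carrier :=
    t.convex_carrier.lineMap_mem h (t.vertex_mem_carrier r) ⟨hε0.le, hε1.le⟩
  have h4 := (hv ⟨hε, h3⟩).trans
    (hv ⟨interior_subset hs.center_mem_interior, h⟩).symm
  rw [AffineMap.lineMap_eq_left_iff] at h4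
  exact h4.elim (fun h => hr h.symm) hε0.ne'

end Triangle

open Triangle

/-- The vertices of `t` are `1 / c` times the combinations of the vertices of `s` with coefficients
from the rows of `A`. -/
def HasCoords (c : ℤ) (A : Matrix (Fin 3) (Fin 3) ℤ) (s t : Triangle) : Prop :=
  ∀ r, c • t.vertex r = ∑ k, A r k • s.vertex k

theorem HasCoords.comp {c d : ℤ} {A B : Matrix (Fin 3) (Fin 3) ℤ} {s t u : Triangle}
    (h₁ : HasCoords c A s t) (h₂ : HasCoords d B t u) : HasCoords (c * d) (B * A) s u := by
  intro r
  rw [mul_smul, h₂ r, Finset.smul_sum]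
  simp_rw [smul_comm c, h₁ _, Finset.smul_sum, smul_smul, Matrix.mul_apply, Finset.sum_smul]
  exact Finset.sum_comm

theorem HasCoords.of_comp {c d : ℤ} (hc : c ≠ 0) {A B : Matrix (Fin 3) (Fin 3) ℤ}
    {s t u : Triangle} (h₁ : HasCoords c A s t) (h₂ : HasCoords (c * d) (B * A) s u) :
    HasCoords d B t u := by
  intro r
  apply smul_right_injective ℂ hc
  have := h₂ r
  simp only [mul_smul] at this
  simp only [this, Finset.smul_sum]
  simp_rw [smul_comm c, h₁ _, Finset.smul_sum, smul_smul, Matrix.mul_apply, Finset.sum_smul]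
  exact Finset.sum_comm

theorem HasCoords.map_smul {c : ℤ} {A : Matrix (Fin 3) (Fin 3) ℤ} {s t : Triangle}
    (h : HasCoords c A s t) (a : ℝ) :
    HasCoords c A (s.map fun z => a • z) (t.map fun z => a • z) := by
  intro r
  simp only [vertex_map, smul_comm _ a, ← Finset.smul_sum, h r]

theorem HasCoords.sum_smul_vertex {c : ℤ} {A : Matrix (Fin 3) (Fin 3) ℤ} {s t : Triangle}
    (h : HasCoords c A s t) (a : Fin 3 → ℝ) :
    (c : ℝ) • ∑ r, a r • t.vertex r = ∑ k, (∑ r, a r * A r k) • s.vertex k := by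
  rw [Finset.smul_sum]
  simp_rw [smul_comm (c : ℝ), Int.cast_smul_eq_zsmul, h _, Finset.smul_sum, Finset.sum_smul]
  rw [Finset.sum_comm]
  simp_rw [mul_smul, Int.cast_smul_eq_zsmul]

theorem sum_sum_mul {c : ℤ} {A : Matrix (Fin 3) (Fin 3) ℤ} (hA : ∀ r, ∑ k, A r k = c)
    (a : Fin 3 → ℝ) : ∑ k, ∑ r, a r * A r k = (∑ r, a r) * c := by
  rw [Finset.sum_comm, Finset.sum_mul]
  refine Finset.sum_congr rfl fun r _ => ?_
  rw [← Finset.mul_sum, ← hA r, Int.cast_sum]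

theorem sum_sum_mul_mul (A : Matrix (Fin 3) (Fin 3) ℤ) (a : Fin 3 → ℝ) (h : Fin 3 → ℤ) :
    ∑ k, (∑ r, a r * A r k) * h k = ∑ r, a r * ((A.mulVec h r : ℤ) : ℝ) := by
  simp_rw [Finset.sum_mul, Matrix.mulVec, dotProduct]
  rw [Finset.sum_comm]
  simp_rw [Int.cast_sum, Finset.mul_sum, Int.cast_mul, mul_assoc]

/-- Convex weights that vanish outside one index. -/
theorem sum_smul_eq_of_eq_zero {a : Fin 3 → ℝ} (h1 : ∑ r, a r = 1) {r₀ : Fin 3}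
    (h0 : ∀ r, r ≠ r₀ → a r = 0) (v : Fin 3 → ℂ) : ∑ r, a r • v r = v r₀ := by
  rw [Finset.sum_eq_single r₀ (fun r _ hr => h0 r hr) (by simp)] at h1
  rw [Finset.sum_eq_single r₀ (fun r _ hr => by simp [h0 r hr]) (by simp), h1, one_smul]

theorem Separates.inter_subset_singleton {c d : ℤ} (hc : 0 < c) (hd : 0 < d)
    {A B : Matrix (Fin 3) (Fin 3) ℤ} {h : Fin 3 → ℤ} (hAB : Separates A B h) {p s t : Triangle}
    (hp : p.Nondegenerate) (hs : HasCoords c A p s) (ht : HasCoords d B p t)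
    (hA : ∀ r, ∑ k, A r k = c) (hB : ∀ r, ∑ k, B r k = d) :
    ∃ v, s.carrier ∩ t.carrier ⊆ {v} := by
  have key : ∀ a b : Fin 3 → ℝ, (∀ r, 0 ≤ a r) → (∀ r, 0 ≤ b r) → ∑ r, a r = 1 → ∑ r, b r = 1 →
      ∑ r, a r • s.vertex r = ∑ r, b r • t.vertex r →
      (∀ r, a r * ((A.mulVec h r : ℤ) : ℝ) = 0) ∧ ∀ r, b r * ((B.mulVec h r : ℤ) : ℝ) = 0 := by
    intro a b ha hb ha1 hb1 hab
    have hc' : (0 : ℝ) < c := by exact_mod_cast hc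
    have hd' : (0 : ℝ) < d := by exact_mod_cast hd
    have h1 := hs.sum_smul_vertex a
    have h2 := ht.sum_smul_vertex b
    have e := hp.eq_of_sum_eq_sum (s := Finset.univ)
      (w₁ := fun k => d * ∑ r, a r * A r k) (w₂ := fun k => c * ∑ r, b r * B r k)
      (by rw [← Finset.mul_sum, ← Finset.mul_sum, sum_sum_mul hA, sum_sum_mul hB, ha1, hb1]; ring)
      (by simp_rw [mul_smul, ← Finset.smul_sum]; rw [← h1, ← h2, hab, smul_comm])
    have e2 : d * ∑ r, a r * ((A.mulVec h r : ℤ) : ℝ) = c * ∑ r, b r * ((B.mulVec h r : ℤ) : ℝ) := by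
      rw [← sum_sum_mul_mul, ← sum_sum_mul_mul, Finset.mul_sum, Finset.mul_sum]
      refine Finset.sum_congr rfl fun k hk => ?_
      rw [← mul_assoc, ← mul_assoc, e k hk]
    have p1 : ∀ r, 0 ≤ a r * ((A.mulVec h r : ℤ) : ℝ) := fun r =>
      mul_nonneg (ha r) (by exact_mod_cast hAB.1 r)
    have p2 : ∀ r, b r * ((B.mulVec h r : ℤ) : ℝ) ≤ 0 := fun r =>
      mul_nonpos_of_nonneg_of_nonpos (hb r) (by exact_mod_cast hAB.2.1 r)
    have q1 := Finset.sum_nonneg fun r (_ : r ∈ Finset.univ) => p1 r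
    have q2 := Finset.sum_nonpos fun r (_ : r ∈ Finset.univ) => p2 r
    have z1 : ∑ r, a r * ((A.mulVec h r : ℤ) : ℝ) = 0 := by
      refine le_antisymm ?_ q1
      by_contra! H
      have := mul_pos hd' H
      have := mul_nonpos_of_nonneg_of_nonpos hc'.le q2
      linarith
    have z2 : ∑ r, b r * ((B.mulVec h r : ℤ) : ℝ) = 0 := by
      rw [z1, mul_zero] at e2
      exact (mul_eq_zero.1 e2.symm).resolve_left hc'.ne'
    exact ⟨fun r => (Finset.sum_eq_zero_iff_of_nonneg fun r _ => p1 r).1 z1 r (Finset.mem_univ r),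
      fun r => (Finset.sum_eq_zero_iff_of_nonpos fun r _ => p2 r).1 z2 r (Finset.mem_univ r)⟩
  rcases hAB.2.2 with ⟨r₀, hr⟩ | ⟨r₀, hr⟩
  · refine ⟨s.vertex r₀, ?_⟩
    rintro x ⟨hx, hx'⟩
    obtain ⟨a, ha, ha1, hxa⟩ := mem_carrier_iff.1 hx
    obtain ⟨b, hb, hb1, hxb⟩ := mem_carrier_iff.1 hx'
    have := (key a b ha hb ha1 hb1 (hxa.trans hxb.symm)).1
    rw [← hxa]
    exact sum_smul_eq_of_eq_zero ha1
      (fun r h => (mul_eq_zero.1 (this r)).resolve_right (by exact_mod_cast hr r h)) _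
  · refine ⟨t.vertex r₀, ?_⟩
    rintro x ⟨hx, hx'⟩
    obtain ⟨a, ha, ha1, hxa⟩ := mem_carrier_iff.1 hx
    obtain ⟨b, hb, hb1, hxb⟩ := mem_carrier_iff.1 hx'
    have := (key a b ha hb ha1 hb1 (hxa.trans hxb.symm)).2
    rw [← hxb]
    exact sum_smul_eq_of_eq_zero hb1
      (fun r h => (mul_eq_zero.1 (this r)).resolve_right (by exact_mod_cast hr r h)) _

/-- A triangle all of whose vertices have a nonpositive coordinate of the same index does not contain
the barycentre. -/
theorem HasCoords.center_not_mem {c : ℤ} (hc : 0 < c) {A : Matrix (Fin 3) (Fin 3) ℤ}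
    {s t : Triangle} (hs : s.Nondegenerate) (h : HasCoords c A s t) (hA : ∀ r, ∑ k, A r k = c)
    {k : Fin 3} (hk : ∀ r, A r k ≤ 0) : s.center ∉ t.carrier := by
  intro hm
  have hc' : (0 : ℝ) < c := by exact_mod_cast hc
  obtain ⟨b, hb, hb1, hxb⟩ := mem_carrier_iff.1 hm
  have h2 := h.sum_smul_vertex b
  have e := hs.eq_of_sum_eq_sum (s := Finset.univ)
    (w₁ := fun k => ∑ r, b r * A r k) (w₂ := fun _ => c * (1 / 3))
    (by rw [sum_sum_mul hA, hb1, Finset.sum_const, Finset.card_univ, Fintype.card_fin]; ring)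
    (by rw [← h2, hxb, center_eq, Finset.smul_sum]; simp_rw [mul_smul]) k (Finset.mem_univ k)
  have : ∑ r, b r * (A r k : ℝ) ≤ 0 := Finset.sum_nonpos fun r _ =>
    mul_nonpos_of_nonneg_of_nonpos (hb r) (by exact_mod_cast hk r)
  linarith

open Triangle

namespace Triangle

/-- The parts of a dissected triangle. -/
noncomputable def child (i : Fin 5) (t : Triangle) : Triangle :=
  ![⟨t.ptD, t.S, t.R⟩, ⟨t.ptN, t.R, t.ptM⟩, ⟨t.ptN, t.ptD, t.ptM⟩,
    ⟨t.ptE, t.ptM, t.ptD⟩, ⟨t.ptE, t.ptM, t.L⟩] i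

theorem dissect_eq_range (t : Triangle) : t.dissect = Set.range fun i => t.child i := by
  ext x
  simp only [dissect, child, Set.mem_insert_iff, Set.mem_singleton_iff, Set.mem_range,
    Fin.exists_fin_succ, eq_comm (b := x)]
  simp

theorem ptD_map (f : ℂ →ᵃ[ℝ] ℂ) (t : Triangle) : (t.map f).ptD = f t.ptD :=
  (f.apply_lineMap _ _ _).symm

theorem ptE_map (f : ℂ →ᵃ[ℝ] ℂ) (t : Triangle) : (t.map f).ptE = f t.ptE :=
  (f.apply_lineMap _ _ _).symm

theorem ptM_map (f : ℂ →ᵃ[ℝ] ℂ) (t : Triangle) : (t.map f).ptM = f t.ptM :=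
  (f.map_midpoint _ _).symm

theorem ptN_map (f : ℂ →ᵃ[ℝ] ℂ) (t : Triangle) : (t.map f).ptN = f t.ptN := by
  rw [ptN, ptD_map]
  exact (f.map_midpoint _ _).symm

theorem child_map (f : ℂ →ᵃ[ℝ] ℂ) (i : Fin 5) (t : Triangle) :
    (t.map f).child i = (t.child i).map f := by
  have hD := ptD_map f t
  have hE := ptE_map f t
  have hM := ptM_map f t
  have hN := ptN_map f t
  fin_cases i <;> simp only [child, hD, hE, hM, hN] <;> rfl

theorem ptD_eq (t : Triangle) : t.ptD = 4 / 5 * t.S + 1 / 5 * t.L := by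
  rw [ptD, AffineMap.lineMap_apply]
  simp
  ring

theorem ptE_eq (t : Triangle) : t.ptE = 2 / 5 * t.S + 3 / 5 * t.L := by
  rw [ptE, AffineMap.lineMap_apply]
  simp
  ring

theorem ptM_eq (t : Triangle) : t.ptM = 1 / 2 * t.R + 1 / 2 * t.L := by
  rw [ptM, midpoint_eq_smul_add]
  simp

theorem ptN_eq (t : Triangle) : t.ptN = 1 / 2 * t.R + 2 / 5 * t.S + 1 / 10 * t.L := by
  rw [ptN, midpoint_eq_smul_add, ptD_eq]
  simp
  ring

theorem hasCoords_child (i : Fin 5) (t : Triangle) :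
    HasCoords 10 (childMatrix i) t (t.child i) := by
  intro r
  fin_cases i <;> fin_cases r <;>
    simp [childMatrix, child, vertex, Fin.sum_univ_three, ptD_eq, ptE_eq, ptM_eq, ptN_eq] <;> ring

end Triangle

theorem eq_zero_of_sum_mul_childMatrix {i : Fin 5} {w : Fin 3 → ℝ}
    (h : ∀ k, ∑ r, w r * childMatrix i r k = 0) : w = 0 := by
  have h0 := h 0
  have h1 := h 1
  have h2 := h 2
  ext r
  fin_cases i <;> simp [childMatrix, Fin.sum_univ_three] at h0 h1 h2 <;> fin_cases r <;>
    simp <;> linarith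

namespace Triangle

theorem Nondegenerate.child {t : Triangle} (ht : t.Nondegenerate) (i : Fin 5) :
    (t.child i).Nondegenerate := by
  rw [Nondegenerate, affineIndependent_iff_of_fintype]
  intro w hw hw'
  rw [Finset.univ.weightedVSub_eq_linear_combination hw] at hw'
  have h := (hasCoords_child i t).sum_smul_vertex w
  rw [hw', smul_zero] at h
  have := ht.eq_zero_of_sum_eq_zero (s := Finset.univ) (w := fun k => ∑ r, w r * childMatrix i r k)
    (by rw [sum_sum_mul (sum_childMatrix i), hw, zero_mul]) h.symm
  exact congrFun (eq_zero_of_sum_mul_childMatrix fun k => this k (Finset.mem_univ k))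

theorem Nondegenerate.map {t : Triangle} (ht : t.Nondegenerate) {f : ℂ →ᵃ[ℝ] ℂ}
    (hf : Function.Injective f) : (t.map f).Nondegenerate := by
  have := (f.affineIndependent_iff hf).2 ht
  rwa [← show (t.map f).vertex = f ∘ t.vertex from funext (vertex_map f t)] at this

/-- A triangle is determined by each of its five parts. -/
theorem child_injective (i : Fin 5) : Function.Injective (Triangle.child i) := by
  intro s t h
  have hD := s.ptD_eq
  have hD' := t.ptD_eq
  have hE := s.ptE_eq
  have hE' := t.ptE_eq
  have hM := s.ptM_eq
  have hM' := t.ptM_eq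
  have hN := s.ptN_eq
  have hN' := t.ptN_eq
  fin_cases i <;> simp only [Triangle.child, Triangle.ext_iff] at h <;> obtain ⟨h1, h2, h3⟩ := h <;>
    simp at h1 h2 h3 <;> rw [Triangle.ext_iff] <;> refine ⟨?_, ?_, ?_⟩ <;> grind

end Triangle

/-- Inflation by the factor `√5`. -/
noncomputable def inflation : ℂ →ᵃ[ℝ] ℂ := (LinearMap.lsmul ℝ ℂ (Real.sqrt 5)).toAffineMap

theorem inflation_injective : Function.Injective inflation :=
  smul_right_injective ℂ (Real.sqrt_ne_zero'.2 (by norm_num : (0 : ℝ) < 5))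

/-- The tile of a supertile with a given address. -/
noncomputable def tile : List (Fin 5) → Triangle
  | [] => prototile
  | i :: u => ((tile u).map inflation).child i

/-- The label of the tile with a given address. -/
def label : List (Fin 5) → Fin 6
  | [] => 0
  | i :: u => nextLabel (label u) i

theorem mem_supertile_iff {n : ℕ} {t : Triangle} :
    t ∈ supertile n ↔ ∃ w : List (Fin 5), w.length = n ∧ tile w = t := by
  induction n generalizing t with
  | zero => simp [supertile, List.length_eq_zero_iff, tile, eq_comm (a := t)]
  | succ n ih =>
    simp only [supertile, Set.mem_iUnion, substitute, dissect_eq_range, ih, Set.mem_range]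
    constructor
    · rintro ⟨_, ⟨u, hu, rfl⟩, i, rfl⟩
      exact ⟨i :: u, by simp [hu], rfl⟩
    · rintro ⟨w, hw, rfl⟩
      obtain ⟨i, u, rfl⟩ := List.exists_cons_of_length_eq_add_one hw
      exact ⟨_, ⟨u, by simpa using hw, rfl⟩, i, rfl⟩

theorem nondegenerate_tile (w : List (Fin 5)) : (tile w).Nondegenerate := by
  induction w with
  | nil =>
    rw [Nondegenerate, affineIndependent_iff_of_fintype]
    intro w hw hw'
    rw [Finset.univ.weightedVSub_eq_linear_combination hw] at hw'
    simp [Fin.sum_univ_three, tile, prototile, vertex, Complex.ext_iff] at hw hw'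
    intro i
    fin_cases i <;> simp <;> linarith
  | cons i u ih => exact (ih.map inflation_injective).child i

theorem child_carrier_subset (i : Fin 5) (t : Triangle) : (t.child i).carrier ⊆ t.carrier := by
  have hR := t.R_mem_carrier
  have hS := t.S_mem_carrier
  have hL := t.L_mem_carrier
  have hD : t.ptD ∈ t.carrier :=
    t.convex_carrier.lineMap_mem hS hL ⟨by norm_num, by norm_num⟩
  have hE : t.ptE ∈ t.carrier :=
    t.convex_carrier.lineMap_mem hS hL ⟨by norm_num, by norm_num⟩
  have hM : t.ptM ∈ t.carrier := t.convex_carrier.midpoint_mem hR hL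
  have hN : t.ptN ∈ t.carrier := t.convex_carrier.midpoint_mem hR hD
  refine convexHull_min ?_ t.convex_carrier
  fin_cases i <;> simp [child, Set.insert_subset_iff, *]

/-- Two tiles of a supertile meet in at most one point, or are in one of finitely many relative
positions, and then their labels are related. -/
theorem inter_subset_singleton_or_hasCoords :
    ∀ w w' : List (Fin 5), w.length = w'.length →
    (∃ v, (tile w).carrier ∩ (tile w').carrier ⊆ {v}) ∨
      ∃ m, HasCoords 10 (positionMatrix m) (tile w) (tile w') ∧ (m = 11 → w = w') ∧
        label w' ∈ neighborLabels m (label w)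
  | [], [], _ => by
    refine Or.inr ⟨11, fun r => ?_, fun _ => rfl, by decide⟩
    fin_cases r <;> simp [positionMatrix, Fin.sum_univ_three]
  | i :: u, j :: u', h => by
    have h : u.length = u'.length := by simpa using h
    rcases inter_subset_singleton_or_hasCoords u u' h with ⟨v, hv⟩ | ⟨m, hm, hu, hl⟩
    · refine Or.inl ⟨inflation v, ?_⟩
      rintro x ⟨hx, hx'⟩
      obtain ⟨y, hy, rfl⟩ := carrier_map _ _ ▸ child_carrier_subset _ _ hx
      obtain ⟨y', hy', e⟩ := carrier_map _ _ ▸ child_carrier_subset _ _ hx'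
      obtain rfl := inflation_injective e
      rw [hv ⟨hy, hy'⟩]
      rfl
    · have hp := (nondegenerate_tile u).map inflation_injective
      have hs := hasCoords_child i ((tile u).map inflation)
      have ht := (hm.map_smul (Real.sqrt 5)).comp (hasCoords_child j ((tile u').map inflation))
      rcases childMatrix_mul_positionMatrix m i j with ⟨m', e, hm', hl'⟩ | ⟨g, -, hg⟩
      · refine Or.inr ⟨m', hs.of_comp (by norm_num) (e ▸ ht), fun H => ?_, hl' _ _ hl⟩
        obtain ⟨rfl, rfl⟩ := hm' H
        rw [hu rfl]
      · exact Or.inl (hg.inter_subset_singleton (by norm_num) (by norm_num) hp hs ht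
          (sum_childMatrix i) (sum_childMatrix_mul_positionMatrix m j))

theorem sum_positionMatrix (m : Fin 12) (r : Fin 3) : ∑ k, positionMatrix m r k = 10 := by
  revert m r; decide

/-- Distinct tiles of a supertile do not overlap. -/
theorem eq_of_center_mem_carrier {w w' : List (Fin 5)} (hl : w.length = w'.length)
    (h : (tile w).center ∈ (tile w').carrier) : w = w' := by
  rcases inter_subset_singleton_or_hasCoords w w' hl with ⟨v, hv⟩ | ⟨m, hm, hw, -⟩
  · exact absurd hv
      ((nondegenerate_tile w).not_inter_subset_singleton (nondegenerate_tile w') h v)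
  · by_cases H : m = 11
    · exact hw H
    · obtain ⟨k, hk⟩ := exists_positionMatrix_nonpos H
      exact absurd h (hm.center_not_mem (by norm_num) (nondegenerate_tile w) (sum_positionMatrix m) hk)

/-- Two triangles share a segment that is not a point. -/
def ShareSegment (s t : Triangle) : Prop :=
  ∃ x y : ℂ, x ≠ y ∧ segment ℝ x y ⊆ s.carrier ∩ t.carrier

theorem ShareSegment.of_map {f : ℂ →ᵃ[ℝ] ℂ} (hf : Function.Injective f) {s t : Triangle}
    (h : ShareSegment (s.map f) (t.map f)) : ShareSegment s t := by
  obtain ⟨x, y, hxy, h⟩ := h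
  rw [carrier_map, carrier_map, ← Set.image_inter hf] at h
  obtain ⟨x', -, rfl⟩ := h (left_mem_segment ℝ x y)
  obtain ⟨y', -, rfl⟩ := h (right_mem_segment ℝ (f x') y)
  rw [← image_segment, Set.image_subset_image_iff hf] at h
  exact ⟨x', y', fun e => hxy (e ▸ rfl), h⟩

theorem ShareSegment.map {f : ℂ →ᵃ[ℝ] ℂ} (hf : Function.Injective f) {s t : Triangle}
    (h : ShareSegment s t) : ShareSegment (s.map f) (t.map f) := by
  obtain ⟨x, y, hxy, h⟩ := h
  refine ⟨f x, f y, hf.ne hxy, ?_⟩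
  rw [carrier_map, carrier_map, ← Set.image_inter hf, ← image_segment]
  exact Set.image_mono h

theorem labelColor_label_ne {w w' : List (Fin 5)} (hl : w.length = w'.length) (hne : w ≠ w')
    (h : ShareSegment (tile w) (tile w')) : labelColor (label w) ≠ labelColor (label w') := by
  rcases inter_subset_singleton_or_hasCoords w w' hl with ⟨v, hv⟩ | ⟨m, -, hw, hm⟩
  · obtain ⟨x, y, hxy, hs⟩ := h
    have hx := hv (hs (left_mem_segment ℝ x y))
    have hy := hv (hs (right_mem_segment ℝ x y))
    exact absurd (hx.trans hy.symm) hxy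
  · exact labelColor_ne_of_mem_neighborLabels (fun H => hne (hw H)) hm

theorem exists_affine_of_isometryEquiv (f : ℂ ≃ᵢ ℂ) :
    ∃ g : ℂ →ᵃ[ℝ] ℂ, Function.Injective g ∧ ⇑g = f :=
  ⟨f.toRealAffineIsometryEquiv.toAffineEquiv.toAffineMap, f.injective, rfl⟩

theorem faceGraph_colorable {T : Set Triangle} (hT : IsPinwheelTiling T) :
    (faceGraph T).Colorable 3 := by
  refine SimpleGraph.nonempty_hom_of_forall_finite_subgraph_hom fun G hG => ?_
  have key : Nonempty (G.coe.Coloring (Fin 3)) := by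
    obtain ⟨n, f, hf⟩ := hT.legal (Subtype.val '' G.verts) (by simp) (hG.image _)
    obtain ⟨g, hg, hgf⟩ := exists_affine_of_isometryEquiv f
    rw [← hgf] at hf
    have H : ∀ t : G.verts, ∃ w : List (Fin 5), w.length = n ∧ (tile w).map g = t.1.1 := by
      intro t
      obtain ⟨s, hs, e⟩ := hf ⟨t.1, t.2, rfl⟩
      obtain ⟨w, hw, rfl⟩ := mem_supertile_iff.1 hs
      exact ⟨w, hw, e⟩
    choose w hw hwt using H
    refine ⟨SimpleGraph.Coloring.mk (fun t => labelColor (label (w t))) fun {s t} h => ?_⟩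
    have h' : (faceGraph T).Adj s.1 t.1 := G.adj_sub h
    refine labelColor_label_ne ((hw s).trans (hw t).symm) (fun e => h'.1 ?_) ?_
    · exact Subtype.ext ((hwt s).symm.trans (e ▸ hwt t))
    · refine ShareSegment.of_map hg ?_
      rw [hwt, hwt]
      exact h'.2
  exact key.some

/-- A pinwheel tiling contains all parts of some supertile of level one. -/
theorem exists_child_mem {T : Set Triangle} (hT : IsPinwheelTiling T) :
    ∃ (p : Triangle), p.Nondegenerate ∧ ∀ j, p.child j ∈ T := by
  have hcov : ∀ x, ∃ t ∈ T, x ∈ t.carrier := fun x => by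
    simpa using hT.covers.ge (Set.mem_univ x)
  choose τ hτ hτx using hcov
  obtain ⟨z, hz⟩ := (Set.ne_univ_iff_exists_notMem _).1 (τ 0).carrier_ne_univ
  let Q : Set ℂ := {0, z} ∪ ⋃ i : Fin 5, ⋃ p ∈ child i ⁻¹' {τ 0}, ⋃ j : Fin 5, {(p.child j).center}
  have hQ : Q.Finite := by
    refine (Set.toFinite _).union (Set.finite_iUnion fun i => Set.Finite.biUnion ?_ fun p _ =>
      Set.finite_iUnion fun j => Set.finite_singleton _)
    exact (Set.finite_singleton _).preimage (child_injective i).injOn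
  obtain ⟨n, f, hf⟩ := hT.legal (τ '' Q) (by rintro _ ⟨x, -, rfl⟩; exact hτ x) (hQ.image τ)
  obtain ⟨g, hg, hgf⟩ := exists_affine_of_isometryEquiv f
  rw [← hgf] at hf
  have H : ∀ x ∈ Q, ∃ w : List (Fin 5), w.length = n ∧ (tile w).map g = τ x := by
    intro x hx
    obtain ⟨s, hs, e⟩ := hf ⟨x, hx, rfl⟩
    obtain ⟨w, hw, rfl⟩ := mem_supertile_iff.1 hs
    exact ⟨w, hw, e⟩
  obtain ⟨w, hw, e0⟩ := H 0 (by simp [Q])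
  match w, hw, e0 with
  | [], hw, e0 =>
    obtain ⟨w', hw', ez⟩ := H z (by simp [Q])
    obtain rfl := List.length_eq_zero_iff.1 (hw'.trans hw.symm)
    exact absurd (hτx z) (by rwa [← ez, e0])
  | i :: u, hw, e0 =>
    refine ⟨((tile u).map inflation).map g,
      ((nondegenerate_tile u).map inflation_injective).map hg, fun j => ?_⟩
    have hc : ∀ k, (((tile u).map inflation).map g).child k = (tile (k :: u)).map g :=
      fun k => child_map g k _
    set p := ((tile u).map inflation).map g
    have hmem : (p.child j).center ∈ Q := Or.inr <| by
      simp only [Set.mem_iUnion]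
      exact ⟨i, p, (hc i).trans e0, j, rfl⟩
    obtain ⟨w', hw', e⟩ := H _ hmem
    have h1 := hτx (p.child j).center
    rw [← e, hc, center_map, carrier_map, hg.mem_set_image] at h1
    have := eq_of_center_mem_carrier (by rw [hw', ← hw]; rfl) h1
    rw [hc, this, e]
    exact hτ _

theorem shareSegment_child {p : Triangle} (hp : p.Nondegenerate) :
    ShareSegment (p.child 0) (p.child 1) ∧ ShareSegment (p.child 0) (p.child 2) ∧
      ShareSegment (p.child 1) (p.child 2) := by
  have hinj : ∀ i, Function.Injective (p.child i).vertex := fun i => (hp.child i).injective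
  have hNR : p.ptN ≠ p.R := (hinj 1).ne (show (0 : Fin 3) ≠ 1 by decide)
  have hND : p.ptN ≠ p.ptD := (hinj 2).ne (show (0 : Fin 3) ≠ 1 by decide)
  have hNM : p.ptN ≠ p.ptM := (hinj 1).ne (show (0 : Fin 3) ≠ 2 by decide)
  have hN0 : p.ptN ∈ (p.child 0).carrier :=
    (p.child 0).convex_carrier.midpoint_mem (p.child 0).L_mem_carrier (p.child 0).R_mem_carrier
  have sub : ∀ {i j : Fin 5} {x y : ℂ}, x ∈ (p.child i).carrier → y ∈ (p.child i).carrier →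
      x ∈ (p.child j).carrier → y ∈ (p.child j).carrier →
      segment ℝ x y ⊆ (p.child i).carrier ∩ (p.child j).carrier := fun h1 h2 h3 h4 =>
    ((convex_carrier _).inter (convex_carrier _)).segment_subset ⟨h1, h3⟩ ⟨h2, h4⟩
  exact ⟨⟨_, _, hNR, sub hN0 (L_mem_carrier _) (R_mem_carrier (p.child 1))
      (S_mem_carrier (p.child 1))⟩,
    ⟨_, _, hND, sub hN0 (R_mem_carrier _) (R_mem_carrier (p.child 2)) (S_mem_carrier (p.child 2))⟩,
    ⟨_, _, hNM, sub (R_mem_carrier (p.child 1)) (L_mem_carrier (p.child 1))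
      (R_mem_carrier (p.child 2)) (L_mem_carrier (p.child 2))⟩⟩

theorem three_le_chromaticNumber {T : Set Triangle} (hT : IsPinwheelTiling T) :
    3 ≤ (faceGraph T).chromaticNumber := by
  obtain ⟨p, hp, hpT⟩ := exists_child_mem hT
  obtain ⟨h01, h02, h12⟩ := shareSegment_child hp
  have hinj : ∀ i, Function.Injective (p.child i).vertex := fun i => (hp.child i).injective
  have n01 : p.child 0 ≠ p.child 1 := fun e =>
    (hinj 2).ne (show (0 : Fin 3) ≠ 1 by decide) (congrArg Triangle.R e).symm
  have n02 : p.child 0 ≠ p.child 2 := fun e =>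
    (hinj 2).ne (show (0 : Fin 3) ≠ 1 by decide) (congrArg Triangle.R e).symm
  have n12 : p.child 1 ≠ p.child 2 := fun e =>
    (hinj 0).ne (show (0 : Fin 3) ≠ 2 by decide) (congrArg Triangle.S e).symm
  let v : Fin 5 → T := fun i => ⟨p.child i, hpT i⟩
  have a01 : (faceGraph T).Adj (v 0) (v 1) := ⟨fun e => n01 (congrArg Subtype.val e), h01⟩
  have a02 : (faceGraph T).Adj (v 0) (v 2) := ⟨fun e => n02 (congrArg Subtype.val e), h02⟩
  have a12 : (faceGraph T).Adj (v 1) (v 2) := ⟨fun e => n12 (congrArg Subtype.val e), h12⟩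
  refine SimpleGraph.le_chromaticNumber_of_pairwise_adj (n := 3) (by simp) ![v 0, v 1, v 2] ?_
  intro i j hij
  fin_cases i <;> fin_cases j <;>
    first | exact absurd rfl hij | assumption | exact SimpleGraph.Adj.symm (by assumption)

end Pinwheel

theorem theorem6p9 (T : Set Pinwheel.Triangle) (hT : Pinwheel.IsPinwheelTiling T) :
    (Pinwheel.faceGraph T).chromaticNumber = 3 :=
  le_antisymm (Pinwheel.faceGraph_colorable hT).chromaticNumber_le
    (Pinwheel.three_le_chromaticNumber hT)
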